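/- **Theorem 6.1 (Order zero coarse-grid correction).** *Setting.* For $n\ge 1$ consider the periodic mesh of $n$ points on $(-1,1)$ with width $h=2/n$ and the advection equation $u_t+\alpha u_x=0$, $\alpha>0$. For odd $p$ and a time step $\tau>0$ with CFL number $\kappa=\alpha\tau/h$, $\varepsilon=\kappa-\lfloor\kappa\rfloor$, let $\mathcal S_p^{(\tau)}\in\mathbb R^{n\times n}$ be the semi-Lagrangian time-stepping operator of order $p$: $(\mathcal S_p^{(\tau)}v)_i$ is the value at the departure point $x_i-\alpha\tau$ of the polynomial of degree at most $p$ interpolating $v$ at the $p+1$ mesh points with indices $i-\lfloor\kappa\rfloor+k$, $-\frac{p+1}{2}\le k\le\frac{p-1}{2}$ (indices modulo $n$), i.e. $$(\mathcal S_p^{(\tau)}v)_i=\sum_{k=-(p+1)/2}^{(p-1)/2}\ell_k(-\varepsilon)\,v_{i-\lfloor\kappa\rfloor+k},$$ with $\ell_k$ the Lagrange basis polynomials of the nodes $-\frac{p+1}{2},\dots,\frac{p-1}{2}$. Fix a coarsening factor $m\ge1$ and a fine time step $\delta t>0$, let $\Phi=\mathcal S_p^{(\delta t)}$ and let the coarse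 operator be the rediscretization $\Psi=\mathcal S_p^{(m\delta t)}$. For a spatial frequency $\omega\in[-\pi,\pi)\cap\frac{2\pi}{n}\mathbb Z$ let $\lambda(\omega)$ and $\mu(\omega)$ be the eigenvalues of $\Phi$ and $\Psi$ on the Fourier mode $e^{\mathrm i\omega x/h}$. For $\theta\in\Theta^{\rm low}=[-\pi/m,\pi/m)$ the Fourier symbols of the coarse-grid space-time operator (block bidiagonal, with blocks $I$ and $-\Psi$) and of its ideal counterpart (with $\Psi$ replaced by $\Phi^m$) on the mode with value $e^{\mathrm i\omega x/h}e^{\mathrm i m\theta k}$ at coarse time level $k$ are $$\widetilde A_1(\omega,m\theta)=1-\mu(\omega)e^{-\mathrm im\theta},\qquad \widetilde A_1^{\rm ideal}(\omega,m\theta)=1-\lambda(\omega)^m e^{-\mathrm im\theta}.$$ Write $E(\omega,\theta)=|\widetilde A_1(\omega,m\theta)-\widetilde A_1^{\rm ideal}(\omega,m\theta)|/|\widetilde A_1(\omega,m\theta)|$. *Statement.* Let $p$ be odd, $m\ge1$, and let $c>0$ be such that neither $c$ nor $mc$ is an integer. All meshes and time steps below have fine-grid CFL number $\alpha\delta t/h=c$.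 (i) For every $\delta>0$ there is a constant $C>0$, depending only on $p,m,c,\delta$, such that for every $K>0$ there is $h_0>0$ with the following property: for all $n$ with $h\le h_0$, all frequencies $\omega\ne0$ with $|\omega|\le Kh$, and all $\theta\in\Theta^{\rm low}$, one has $\widetilde A_1(\omega,m\theta)\ne0$ and $$E(\omega,\theta)\le C|\omega|^{p+1}\ \text{ if }\ \Big|\theta+\frac{\omega\alpha\delta t}{h}\Big|\ge\delta,\qquad E(\omega,\theta)\le C\ \text{ if }\ \Big|\theta+\frac{\omega\alpha\delta t}{h}\Big|<\delta .$$ That is, asymptotically smooth modes that are not characteristic components have relative coarse-grid error $O(\omega^{p+1})$, and asymptotically smooth characteristic components have relative coarse-grid error $O(1)$. (ii) If $m\ge2$, order zero cannot be improved for characteristic components: for every $B\ge0$ there is $b>0$, depending only on $p,m,c,B$, such that for every $K>0$ there is $h_0>0$ so that $E(\omega,\theta)\ge b$ for all $n$ with $h\le h_0$, all frequencies $\omega\ne0$ with $|\omega|\le Kh$, and all $\theta\in\Theta^{\rm low}$ with $|\theta+\omega\alpha\delta t/h|\le B|\omega|^{p+1}$. -/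

import Mathlib

noncomputable section

open Matrix

namespace MGRITAdvection

/-- Mesh width `h` of the periodic mesh with `n` equispaced points on `(-1, 1)`. -/
def meshWidth (n : ℕ) : ℝ := 2 / n

/-- CFL number `α δt / h` of a time step `δt` for `u_t + α u_x = 0` on the `n`-point mesh. -/
def cfl (n : ℕ) (α δt : ℝ) : ℝ := α * δt / meshWidth n

/-- Offsets, in mesh widths and relative to the east neighbour of a departure point, of the
`p + 1` mesh points used for interpolation (`p` odd): `-(p+1)/2, …, (p-1)/2`. -/
def stencil (p : ℕ) : Finset ℤ := Finset.Icc (-(((p : ℤ) + 1) / 2)) (((p : ℤ) - 1) / 2)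

/-- Weight of the mesh point with offset `k` when the polynomial of degree at most `p` through the
stencil is evaluated at distance `ε` (in mesh widths) to the west of the east neighbour. -/
def interpWeight (p : ℕ) (ε : ℝ) (k : ℤ) : ℝ :=
  (Lagrange.basis (stencil p) (fun q : ℤ => (q : ℝ)) k).eval (-ε)

/-- The semi-Lagrangian time-stepping operator of odd order `p` with time step `δt` for
`u_t + α u_x = 0` on the periodic `n`-point mesh. The characteristic through node `i` departs from
`x_i - α δt = x_i - (⌊c⌋ + ε) h`, where `c` is the CFL number and `ε` its fractional part; the east
neighbour of this departure point is node `i - ⌊c⌋`. -/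
def semiLagrangian (p n : ℕ) (α δt : ℝ) : Matrix (ZMod n) (ZMod n) ℝ :=
  Matrix.of fun i j => ∑ k ∈ stencil p,
    if j = i + ((k - ⌊cfl n α δt⌋ : ℤ) : ZMod n) then
      interpWeight p (Int.fract (cfl n α δt)) k else 0

/-- The `n` spatial frequencies in `[-π, π)` for which `exp (i ω x / h)` is periodic on the mesh. -/
def frequencies (n : ℕ) : Set ℝ :=
  {ω | ω ∈ Set.Ico (-Real.pi) Real.pi ∧ ∃ k : ℤ, ω = 2 * Real.pi * k / n}

/-- Low temporal frequencies `[-π/m, π/m)`. -/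
def lowFrequencies (m : ℕ) : Set ℝ := Set.Ico (-(Real.pi / m)) (Real.pi / m)

/-- The spatial Fourier mode `exp (i ω x / h)` at the mesh points `x = j h`; each residue class is
represented by an integer `j` of least absolute value. -/
def spatialMode (n : ℕ) (ω : ℝ) : ZMod n → ℂ :=
  fun j => Complex.exp (Complex.I * ω * (j.valMinAbs : ℂ))

/-- The space-time Fourier mode whose value at time level `k` and mesh point `j` is
`exp (i ω j) exp (i ϑ k)`. -/
def spaceTimeMode (n : ℕ) (ω ϑ : ℝ) : ℤ → ZMod n → ℂ :=
  fun k j => spatialMode n ω j * Complex.exp (Complex.I * ϑ * (k : ℂ))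

/-- The block lower bidiagonal space-time operator (`I` on the diagonal, `-Ψ` below it) of the
one-step method with time-stepping operator `Ψ`, on a temporal grid without boundary. -/
def spaceTimeOperator {n : ℕ} [NeZero n] (Ψ : Matrix (ZMod n) (ZMod n) ℝ)
    (w : ℤ → ZMod n → ℂ) : ℤ → ZMod n → ℂ :=
  fun k => w k - (Ψ.map Complex.ofReal) *ᵥ w (k - 1)

/-- The Fourier symbol of `spaceTimeOperator Ψ`: its eigenvalue on `spaceTimeMode n ω ϑ`, read off
at time level `0` and mesh point `0`, where the mode equals `1`. -/
def fourierSymbol {n : ℕ} [NeZero n] (Ψ : Matrix (ZMod n) (ZMod n) ℝ) (ω ϑ : ℝ) : ℂ :=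
  spaceTimeOperator Ψ (spaceTimeMode n ω ϑ) 0 0

/-- Symbol at `(ω, m θ)` of the coarse-grid operator rediscretized with time step `m δt`. -/
def coarseSymbol (p m n : ℕ) [NeZero n] (α δt ω θ : ℝ) : ℂ :=
  fourierSymbol (semiLagrangian p n α (m * δt)) ω (m * θ)

/-- Symbol at `(ω, m θ)` of the coarse-grid operator with the ideal time-stepping operator, the
`m`-th power of the fine-grid one. -/
def idealSymbol (p m n : ℕ) [NeZero n] (α δt ω θ : ℝ) : ℂ :=
  fourierSymbol (semiLagrangian p n α δt ^ m) ω (m * θ)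

/-- Relative error of the coarse-grid operator on the mode with frequencies `(ω, θ)`. -/
def relativeCoarseError (p m n : ℕ) [NeZero n] (α δt ω θ : ℝ) : ℝ :=
  ‖coarseSymbol p m n α δt ω θ - idealSymbol p m n α δt ω θ‖ / ‖coarseSymbol p m n α δt ω θ‖

/-- The distance of `θ` from the characteristic frequency `-ω α δt / h`. -/
def charDistance (n : ℕ) (α δt ω θ : ℝ) : ℝ := |θ + ω * α * δt / meshWidth n|

theorem spatialMode_intCast {n : ℕ} [NeZero n] {ω : ℝ} (hω : ω ∈ frequencies n) (a : ℤ) :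
    spatialMode n ω (a : ZMod n) = Complex.exp (Complex.I * ω * (a : ℂ)) := by
  obtain ⟨-, k, rfl⟩ := hω
  have hn : (n : ℂ) ≠ 0 := by exact_mod_cast NeZero.ne n
  have h : (((a : ZMod n).valMinAbs : ℤ) : ZMod n) = ((a : ℤ) : ZMod n) :=
    ZMod.coe_valMinAbs _
  obtain ⟨b, hb⟩ := (ZMod.intCast_eq_intCast_iff_dvd_sub _ _ n).1 h
  have hb' : (a : ℂ) = ((a : ZMod n).valMinAbs : ℂ) + n * b := by
    have : a = (a : ZMod n).valMinAbs + n * b := by omega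
    exact_mod_cast this
  unfold spatialMode
  rw [Complex.exp_eq_exp_iff_exists_int]
  refine ⟨-(k * b), ?_⟩
  rw [hb']
  push_cast
  field_simp
  ring

theorem spatialMode_add {n : ℕ} [NeZero n] {ω : ℝ} (hω : ω ∈ frequencies n) (i : ZMod n)
    (a : ℤ) : spatialMode n ω (i + (a : ZMod n)) =
      Complex.exp (Complex.I * ω * (a : ℂ)) * spatialMode n ω i := by
  have hi : i = ((i.valMinAbs : ℤ) : ZMod n) := (ZMod.coe_valMinAbs i).symm
  rw [hi, ← Int.cast_add, spatialMode_intCast hω, spatialMode_intCast hω, ← Complex.exp_add]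
  congr 1
  push_cast
  ring

theorem semiLagrangian_mulVec (p : ℕ) {n : ℕ} [NeZero n] (α δt : ℝ) {ω : ℝ}
    (hω : ω ∈ frequencies n) :
    ∃ s : ℂ, ((semiLagrangian p n α δt).map Complex.ofReal) *ᵥ spatialMode n ω =
      s • spatialMode n ω := by
  refine ⟨∑ k ∈ stencil p, (interpWeight p (Int.fract (cfl n α δt)) k : ℂ) *
    Complex.exp (Complex.I * ω * ((k - ⌊cfl n α δt⌋ : ℤ) : ℂ)), ?_⟩
  ext i
  simp only [Matrix.mulVec, dotProduct, semiLagrangian, Matrix.map_apply, Matrix.of_apply,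
    Complex.ofReal_sum, Finset.sum_mul, Pi.smul_apply, smul_eq_mul]
  rw [Finset.sum_comm]
  refine Finset.sum_congr rfl fun k _ => ?_
  rw [Finset.sum_eq_single (i + ((k - ⌊cfl n α δt⌋ : ℤ) : ZMod n))]
  · rw [if_pos rfl, spatialMode_add hω]
    ring
  · intro b _ hb
    rw [if_neg hb]
    simp
  · intro h
    exact absurd (Finset.mem_univ _) h

/-- The space-time modes are eigenfunctions, and `fourierSymbol` is the eigenvalue, for every power
of a semi-Lagrangian time-stepping operator. -/
theorem spaceTimeOperator_spaceTimeMode (p r : ℕ) {n : ℕ} [NeZero n] (α δt : ℝ) {ω : ℝ}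
    (hω : ω ∈ frequencies n) (ϑ : ℝ) :
    spaceTimeOperator (semiLagrangian p n α δt ^ r) (spaceTimeMode n ω ϑ) =
      fourierSymbol (semiLagrangian p n α δt ^ r) ω ϑ • spaceTimeMode n ω ϑ := by
  obtain ⟨s, hs⟩ := semiLagrangian_mulVec p α δt hω
  have hr : ((semiLagrangian p n α δt ^ r).map Complex.ofReal) *ᵥ spatialMode n ω =
      s ^ r • spatialMode n ω := by
    have hmap : (semiLagrangian p n α δt ^ r).map Complex.ofReal =
        ((semiLagrangian p n α δt).map Complex.ofReal) ^ r :=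
      map_pow (Complex.ofRealHom.mapMatrix (m := ZMod n)) _ r
    rw [hmap]
    induction r with
    | zero => simp
    | succ r ih =>
      have ih' := ih (map_pow (Complex.ofRealHom.mapMatrix (m := ZMod n)) _ r)
      rw [pow_succ', ← Matrix.mulVec_mulVec, ih', Matrix.mulVec_smul, hs, smul_smul, pow_succ]
  have key : ∀ (k : ℤ) (j : ZMod n),
      spaceTimeOperator (semiLagrangian p n α δt ^ r) (spaceTimeMode n ω ϑ) k j =
        (1 - s ^ r * Complex.exp (-(Complex.I * ϑ))) * spaceTimeMode n ω ϑ k j := by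
    intro k j
    have hm : spaceTimeMode n ω ϑ (k - 1) =
        (Complex.exp (Complex.I * ϑ * (k : ℂ)) * Complex.exp (-(Complex.I * ϑ))) •
          spatialMode n ω := by
      ext j
      simp only [spaceTimeMode, Pi.smul_apply, smul_eq_mul, ← Complex.exp_add]
      rw [mul_comm]
      congr 2
      push_cast
      ring
    simp only [spaceTimeOperator, hm, Matrix.mulVec_smul, hr, Pi.sub_apply, Pi.smul_apply,
      smul_eq_mul, spaceTimeMode]
    ring
  funext k j
  have h1 : spaceTimeMode n ω ϑ 0 0 = 1 := by
    simp [spaceTimeMode, spatialMode]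
  simp only [fourierSymbol, key, h1, Pi.smul_apply, smul_eq_mul, mul_one]

end MGRITAdvection

end

open MGRITAdvection

noncomputable section

open Matrix

namespace MGRITAdvection

open Filter Asymptotics Topology Polynomial
open scoped Nat

/-! On a Fourier mode, one step multiplies by the exact transport factor `exp (-iωc)` and by a
reduced symbol depending only on ω and the fractional CFL number ε. Write p = 2r + 1. Interpolation
is exact up to degree p, so the reduced symbol is 1 - D(ε) ω^(p+1) + o(ω^(p+1)), where D =
`dissipation r` is positive on (0, 1) (`reducedSymbol_isLittleO`). Over a coarse step both operators
carry the same transport factor. Their space-time symbols are therefore 1 - z u and 1 - w u with a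
common phase u = exp(-im(θ + ωc)), where z ≈ 1 - a ω^(p+1), w ≈ 1 - b ω^(p+1), a = D(fract(mc)) and
b = m D(fract c).

The numerator of E is |a - b| |ω|^(p+1) up to a small multiple of |ω|^(p+1). For small ω the
denominator is at least (a/2) |ω|^(p+1) at every θ, because dissipation alone keeps |z| below 1. It
is bounded below away from the characteristic frequency, and it is O(|ω|^(p+1)) within O(|ω|^(p+1))
of that frequency. This yields the upper bounds and, if a ≠ b, the lower bound.

The crux is a < b for m ≥ 2 (`dissipation_fract_lt`). D is an increasing function of ε(1 - ε), and a
product estimate reduces the claim, for every r at once, to an elementary inequality between ε and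
fract(mε). -/

/-! ### Moments of the interpolation weights -/

theorem stencil_odd (r : ℕ) : stencil (2 * r + 1) = Finset.Icc (-((r : ℤ) + 1)) (r : ℤ) := by
  unfold stencil
  congr 1 <;> push_cast <;> omega

theorem card_stencil_odd (r : ℕ) : (stencil (2 * r + 1)).card = 2 * r + 2 := by
  rw [stencil_odd, Int.card_Icc]
  omega

theorem injOn_intCast (s : Set ℤ) : Set.InjOn (fun q : ℤ => (q : ℝ)) s :=
  Int.cast_injective.injOn

/-- Interpolation is exact on polynomials of degree less than the number of nodes. -/
theorem sum_interpWeight_mul_eval (p : ℕ) (ε : ℝ) (f : ℝ[X])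
    (hf : f.degree < (stencil p).card) :
    ∑ k ∈ stencil p, interpWeight p ε k * f.eval (k : ℝ) = f.eval (-ε) := by
  have h := Lagrange.eq_interpolate (injOn_intCast (stencil p : Set ℤ)) hf
  conv_rhs => rw [h, Lagrange.interpolate_apply, eval_finsetSum]
  refine Finset.sum_congr rfl fun k _ => ?_
  rw [eval_mul, eval_C, mul_comm, interpWeight]

theorem sum_interpWeight_mul_pow (r : ℕ) (ε : ℝ) {j : ℕ} (hj : j < 2 * r + 2) :
    ∑ k ∈ stencil (2 * r + 1), interpWeight (2 * r + 1) ε k * ((k : ℝ) + ε) ^ j =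
      if j = 0 then 1 else 0 := by
  have h := sum_interpWeight_mul_eval (2 * r + 1) ε ((X + C ε) ^ j) (by
    rw [card_stencil_odd, degree_pow, degree_X_add_C]
    simpa using by exact_mod_cast hj)
  simpa [zero_pow_eq] using h

theorem sum_interpWeight_mul_pow_card (r : ℕ) (ε : ℝ) :
    ∑ k ∈ stencil (2 * r + 1), interpWeight (2 * r + 1) ε k * ((k : ℝ) + ε) ^ (2 * r + 2) =
      -∏ q ∈ stencil (2 * r + 1), (-ε - (q : ℝ)) := by
  set N := Lagrange.nodal (stencil (2 * r + 1)) (fun q : ℤ => (q : ℝ)) with hN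
  have hdeg : ((X + C ε : ℝ[X]) ^ (2 * r + 2)).degree = ((2 * r + 2 : ℕ) : WithBot ℕ) := by
    rw [degree_pow, degree_X_add_C]
    simp
  -- Subtracting the nodal polynomial cancels the leading term, so interpolation is exact on the
  -- difference, while the values at the nodes do not change.
  have h := sum_interpWeight_mul_eval (2 * r + 1) ε ((X + C ε) ^ (2 * r + 2) - N) (by
    have : ((2 * r + 2 : ℕ) : WithBot ℕ) = ((X + C ε : ℝ[X]) ^ (2 * r + 2)).degree := hdeg.symm
    rw [card_stencil_odd, this]
    refine degree_sub_lt_left ?_ ((monic_X_add_C ε).pow _).ne_zero ?_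
    · rw [hdeg, hN, Lagrange.degree_nodal, card_stencil_odd]
    · rw [((monic_X_add_C ε).pow _).leadingCoeff, hN, Lagrange.nodal_monic.leadingCoeff])
  have hl : ∀ k ∈ stencil (2 * r + 1), interpWeight (2 * r + 1) ε k * ((k : ℝ) + ε) ^ (2 * r + 2) =
      interpWeight (2 * r + 1) ε k * ((X + C ε) ^ (2 * r + 2) - N).eval (k : ℝ) := by
    intro k hk
    have : N.eval (k : ℝ) = 0 :=
      Lagrange.eval_nodal_at_node (v := fun q : ℤ => (q : ℝ)) hk
    simp [this]
  rw [Finset.sum_congr rfl hl, h, eval_sub, hN, Lagrange.eval_nodal]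
  simp

/-! ### Comparison of the fine and coarse error constants -/

/-- The unnormalised leading error constant of interpolation as a function of `s = ε (1 - ε)`. -/
def nodeProduct (r : ℕ) (s : ℝ) : ℝ := ∏ j ∈ Finset.range (r + 1), ((j : ℝ) * (j + 1) + s)

/-- The nodes j and -(j + 1) pair up: (-ε - j)(-ε + j + 1) = -(j(j + 1) + ε(1 - ε)). There are r + 1
pairs. -/
theorem prod_stencil (r : ℕ) (ε : ℝ) :
    (-1) ^ (r + 1) * ∏ q ∈ stencil (2 * r + 1), (-ε - (q : ℝ)) =
      nodeProduct r (ε * (1 - ε)) := by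
  rw [stencil_odd, nodeProduct]
  induction r with
  | zero =>
    have : Finset.Icc (-(((0 : ℕ) : ℤ) + 1)) ((0 : ℕ) : ℤ) = {-1, 0} := by decide
    rw [this, Finset.prod_pair (by decide)]
    simp
    ring
  | succ r ih =>
    have : Finset.Icc (-(((r + 1 : ℕ) : ℤ) + 1)) ((r + 1 : ℕ) : ℤ) =
        insert (-((r : ℤ) + 2)) (insert ((r : ℤ) + 1) (Finset.Icc (-((r : ℤ) + 1)) (r : ℤ))) := by
      ext x
      simp only [Finset.mem_Icc, Finset.mem_insert]
      push_cast
      omega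
    rw [this, Finset.prod_insert (by simp; omega), Finset.prod_insert (by simp),
      Finset.prod_range_succ, ← ih, pow_succ]
    push_cast
    ring

theorem nodeProduct_pos (r : ℕ) {s : ℝ} (hs : 0 < s) : 0 < nodeProduct r s :=
  Finset.prod_pos fun j _ => by positivity

theorem nodeProduct_mono (r : ℕ) {s t : ℝ} (hs : 0 < s) (hst : s ≤ t) :
    nodeProduct r s ≤ nodeProduct r t :=
  Finset.prod_le_prod (fun j _ => by positivity) fun j _ => by gcongr

/-- The factor j = 0 contributes t/s. Each factor with j ≥ 1 grows by at most exp((t - s)/(j(j +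
1))), and these exponents telescope. -/
theorem mul_nodeProduct_le (r : ℕ) {s t : ℝ} (hs : 0 < s) (hst : s ≤ t) :
    s * nodeProduct r t ≤
      t * nodeProduct r s * Real.exp ((t - s) * (1 - 1 / ((r : ℝ) + 1))) := by
  induction r with
  | zero => simp [nodeProduct, mul_comm]
  | succ r ih =>
    have hstep : ((r + 1 : ℕ) : ℝ) * ((r + 1 : ℕ) + 1) + t ≤
        (((r + 1 : ℕ) : ℝ) * ((r + 1 : ℕ) + 1) + s) *
          Real.exp ((t - s) * (1 / (((r + 1 : ℕ) : ℝ) * ((r + 1 : ℕ) + 1)))) := by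
      set a : ℝ := ((r + 1 : ℕ) : ℝ) * ((r + 1 : ℕ) + 1) with ha
      have hapos : 0 < a := by rw [ha]; positivity
      have h1 := Real.add_one_le_exp ((t - s) * (1 / a))
      calc a + t ≤ (a + s) * ((t - s) * (1 / a) + 1) := by
            have : (a + s) * ((t - s) * (1 / a) + 1) = a + t + s * (t - s) / a := by
              field_simp; ring
            rw [this]
            have : 0 ≤ s * (t - s) / a := by
              have := sub_nonneg.2 hst
              positivity
            linarith
        _ ≤ _ := by gcongr
    have hexp : (t - s) * (1 - 1 / (((r + 1 : ℕ) : ℝ) + 1)) =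
        (t - s) * (1 - 1 / ((r : ℝ) + 1)) +
          (t - s) * (1 / (((r + 1 : ℕ) : ℝ) * ((r + 1 : ℕ) + 1))) := by
      push_cast
      field_simp
      ring
    have ht : 0 < t := hs.trans_le hst
    have hG := nodeProduct_pos r hs
    have e : ∀ x, nodeProduct (r + 1) x =
        nodeProduct r x * (((r + 1 : ℕ) : ℝ) * ((r + 1 : ℕ) + 1) + x) := fun x =>
      Finset.prod_range_succ _ _
    rw [e, e, hexp, Real.exp_add]
    calc s * (nodeProduct r t * (((r + 1 : ℕ) : ℝ) * ((r + 1 : ℕ) + 1) + t))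
        = (s * nodeProduct r t) * (((r + 1 : ℕ) : ℝ) * ((r + 1 : ℕ) + 1) + t) := by ring
      _ ≤ _ := mul_le_mul ih hstep (by positivity) (by positivity)
      _ = _ := by ring

/-- With 1 - md = (1 - d)(1 - y), the claim is (1 - y) exp x < 1. This follows from 1 - y ≤ exp(-y)
and x < y. -/
theorem lt_of_small_multiple {d m : ℝ} (hd : 0 < d) (hd' : d < 1) (hm : 1 < m) :
    m * d * (1 - m * d) * Real.exp (m * d * (1 - m * d) - d * (1 - d)) < m * (d * (1 - d)) := by
  have h1d : 0 < 1 - d := by linarith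
  set y := (m - 1) * d / (1 - d) with hy
  have hy' : 1 - m * d = (1 - d) * (1 - y) := by
    rw [hy]; field_simp; ring
  set x := m * d * (1 - m * d) - d * (1 - d) with hx
  have hxy : x < y := by
    have : y - x = (m - 1) * d * (d / (1 - d) + (m + 1) * d) := by
      rw [hy, hx]; field_simp; ring
    have : 0 < y - x := by
      rw [this]
      have : 0 < m - 1 := by linarith
      positivity
    linarith
  have hlt : (1 - y) * Real.exp x < 1 := by
    have h1 : 1 - y ≤ Real.exp (-y) := by linarith [Real.add_one_le_exp (-y)]
    calc (1 - y) * Real.exp x ≤ Real.exp (-y) * Real.exp x := by gcongr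
      _ = Real.exp (x - y) := by rw [← Real.exp_add]; ring_nf
      _ < 1 := Real.exp_lt_one_iff.mpr (by linarith)
  have : m * d * (1 - m * d) * Real.exp x = m * (d * (1 - d)) * ((1 - y) * Real.exp x) := by
    rw [hy']; ring
  rw [this]
  have : 0 < m * (d * (1 - d)) := by positivity
  nlinarith

theorem exp_quarter_lt : Real.exp (1 / 4) < 3 / 2 := by
  have h : Real.exp (1 / 4) ^ 4 = Real.exp 1 := by
    rw [← Real.exp_nat_mul]; norm_num
  by_contra! hc
  have : (3 / 2 : ℝ) ^ 4 ≤ Real.exp (1 / 4) ^ 4 := by gcongr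
  rw [h] at this
  linarith [Real.exp_one_lt_d9]

/-- If ε is within 1/(2m) of 0 or 1, the fractional part is explicit and `lt_of_small_multiple`
applies to ε or 1 - ε. Otherwise f(1 - f) ≤ 1/4 and exp(1/4) < 3/2 bound the left side by 3/8, which
mε(1 - ε) reaches. -/
theorem fract_mul_exp_lt {ε : ℝ} (h0 : 0 < ε) (h1 : ε < 1) {m : ℕ} (hm : 2 ≤ m)
    (hlt : ε * (1 - ε) ≤ Int.fract (m * ε) * (1 - Int.fract (m * ε))) :
    Int.fract (m * ε) * (1 - Int.fract (m * ε)) *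
      Real.exp (Int.fract (m * ε) * (1 - Int.fract (m * ε)) - ε * (1 - ε)) <
        m * (ε * (1 - ε)) := by
  have hm' : (2 : ℝ) ≤ m := by exact_mod_cast hm
  rcases le_or_gt (m * ε) (1 / 2) with hA | hA
  · have : Int.fract ((m : ℝ) * ε) = m * ε :=
      Int.fract_eq_self.2 ⟨by positivity, by linarith⟩
    rw [this]
    exact lt_of_small_multiple h0 h1 (by linarith)
  rcases le_or_gt (m * (1 - ε)) (1 / 2) with hB | hB
  · have : Int.fract ((m : ℝ) * ε) = 1 - m * (1 - ε) := by
      rw [Int.fract_eq_iff]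
      refine ⟨by linarith, ?_, (m : ℤ) - 1, by push_cast; ring⟩
      have : 0 < (m : ℝ) * (1 - ε) := mul_pos (by linarith) (by linarith)
      linarith
    rw [this]
    convert lt_of_small_multiple (d := 1 - ε) (m := m) (by linarith) (by linarith) (by linarith)
      using 2 <;> ring_nf
  · set f := Int.fract ((m : ℝ) * ε)
    have hf : f * (1 - f) ≤ 1 / 4 := by nlinarith [sq_nonneg (f - 1 / 2)]
    have hs : 0 < ε * (1 - ε) := mul_pos h0 (by linarith)
    have he : Real.exp (f * (1 - f) - ε * (1 - ε)) < 3 / 2 :=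
      (Real.exp_le_exp.2 (by linarith)).trans_lt exp_quarter_lt
    have hms : 3 / 8 ≤ m * (ε * (1 - ε)) := by
      -- Expanding gives m²ε(1 - ε) > m/2 - 1/4, which is at least 3m/8 because m ≥ 2.
      have h2 : 0 < (m * ε - 1 / 2) * (m * (1 - ε) - 1 / 2) :=
        mul_pos (by linarith) (by linarith)
      have h3 : (m : ℝ) * (3 / 8) ≤ m * (m * (ε * (1 - ε))) := by nlinarith
      exact le_of_mul_le_mul_left h3 (by linarith)
    have := Real.exp_pos (f * (1 - f) - ε * (1 - ε))
    nlinarith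

/-- The leading constant of the dissipation error of `reducedSymbol`. -/
def dissipation (r : ℕ) (ε : ℝ) : ℝ := nodeProduct r (ε * (1 - ε)) / (2 * r + 2)!

theorem dissipation_pos (r : ℕ) {ε : ℝ} (h0 : 0 < ε) (h1 : ε < 1) : 0 < dissipation r ε :=
  div_pos (nodeProduct_pos r (mul_pos h0 (by linarith))) (by positivity)

theorem dissipation_fract_lt (r : ℕ) {ε : ℝ} (h0 : 0 < ε) (h1 : ε < 1) {m : ℕ} (hm : 2 ≤ m)
    (hfr : 0 < Int.fract (m * ε)) :
    dissipation r (Int.fract (m * ε)) < m * dissipation r ε := by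
  have hm' : (2 : ℝ) ≤ m := by exact_mod_cast hm
  unfold dissipation
  rw [← mul_div_assoc]
  refine div_lt_div_of_pos_right ?_ (by positivity)
  have hs : 0 < ε * (1 - ε) := mul_pos h0 (by linarith)
  have ht : 0 < Int.fract (m * ε) * (1 - Int.fract (m * ε)) :=
    mul_pos hfr (by linarith [Int.fract_lt_one (m * ε)])
  have hG := nodeProduct_pos r hs
  rcases le_total (ε * (1 - ε)) (Int.fract (m * ε) * (1 - Int.fract (m * ε))) with h | h
  · have hlt := fract_mul_exp_lt h0 h1 hm h
    have hle := mul_nodeProduct_le r hs h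
    set s := ε * (1 - ε)
    set t := Int.fract (m * ε) * (1 - Int.fract (m * ε))
    have hexp : Real.exp ((t - s) * (1 - 1 / ((r : ℝ) + 1))) ≤ Real.exp (t - s) := by
      apply Real.exp_le_exp.2
      have : 0 ≤ (t - s) * (1 / ((r : ℝ) + 1)) :=
        mul_nonneg (sub_nonneg.2 h) (by positivity)
      linarith
    refine lt_of_mul_lt_mul_left (a := s) ?_ hs.le
    calc s * nodeProduct r t ≤ _ := hle
      _ ≤ t * nodeProduct r s * Real.exp (t - s) := by gcongr
      _ = nodeProduct r s * (t * Real.exp (t - s)) := by ring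
      _ < nodeProduct r s * (m * s) := by gcongr
      _ = _ := by ring
  · have := nodeProduct_mono r ht h
    nlinarith

/-! ### Small-frequency expansion of the reduced symbol -/

/-- The Fourier symbol of the semi-Lagrangian operator without the exact transport factor. -/
def reducedSymbol (p : ℕ) (ε ω : ℝ) : ℂ :=
  ∑ k ∈ stencil p, (interpWeight p ε k : ℂ) * Complex.exp (Complex.I * ω * ((k : ℂ) + ε))

/-- Expand each exponential to order p + 1: the moments of order 1 to p vanish, and the next one is
the nodal product. -/
theorem reducedSymbol_isLittleO (r : ℕ) (ε : ℝ) :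
    (fun ω : ℝ => reducedSymbol (2 * r + 1) ε ω - (1 - (dissipation r ε * ω ^ (2 * r + 2) : ℝ)))
      =o[𝓝 0] fun ω : ℝ => ω ^ (2 * r + 2) := by
  have key : ∀ ω : ℝ, reducedSymbol (2 * r + 1) ε ω - (1 - (dissipation r ε * ω ^ (2 * r + 2) : ℝ))
      = ∑ k ∈ stencil (2 * r + 1), (interpWeight (2 * r + 1) ε k : ℂ) *
        (Complex.exp (Complex.I * ω * ((k : ℂ) + ε)) -
          ∑ j ∈ Finset.range (2 * r + 2 + 1), (Complex.I * ω * ((k : ℂ) + ε)) ^ j / j !) := by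
    intro ω
    simp only [mul_sub, Finset.sum_sub_distrib]
    rw [reducedSymbol]
    congr 1
    have hC : ∀ j, (∑ k ∈ stencil (2 * r + 1),
        (interpWeight (2 * r + 1) ε k : ℂ) * ((k : ℂ) + ε) ^ j) =
        ((∑ k ∈ stencil (2 * r + 1), interpWeight (2 * r + 1) ε k * ((k : ℝ) + ε) ^ j : ℝ) : ℂ) := by
      intro j; push_cast; rfl
    have hsum : ∑ k ∈ stencil (2 * r + 1), (interpWeight (2 * r + 1) ε k : ℂ) *
        ∑ j ∈ Finset.range (2 * r + 2 + 1), (Complex.I * ω * ((k : ℂ) + ε)) ^ j / j ! =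
        ∑ j ∈ Finset.range (2 * r + 2 + 1), (Complex.I * ω) ^ j / j ! *
          ((∑ k ∈ stencil (2 * r + 1),
            interpWeight (2 * r + 1) ε k * ((k : ℝ) + ε) ^ j : ℝ) : ℂ) := by
      simp only [← hC, Finset.mul_sum]
      rw [Finset.sum_comm]
      refine Finset.sum_congr rfl fun j _ => Finset.sum_congr rfl fun k _ => ?_
      rw [mul_pow (Complex.I * ω)]
      ring
    rw [hsum, Finset.sum_range_succ, sum_interpWeight_mul_pow_card,
      Finset.sum_eq_single_of_mem 0 (by simp) (fun j hj hj0 => by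
        rw [sum_interpWeight_mul_pow r ε (Finset.mem_range.1 hj), if_neg hj0]; simp),
      sum_interpWeight_mul_pow r ε (by omega), dissipation, ← prod_stencil, mul_pow Complex.I (ω : ℂ) (2 * r + 2)]
    -- This sign is the one in `prod_stencil`, so the leading correction is real and negative.
    have hI : Complex.I ^ (2 * r + 2) = (-1) ^ (r + 1) := by
      rw [show 2 * r + 2 = 2 * (r + 1) by ring, pow_mul, Complex.I_sq]
    rw [hI]
    push_cast
    simp
    ring
  simp only [key]
  have hk : ∀ k ∈ stencil (2 * r + 1), (fun ω : ℝ => (interpWeight (2 * r + 1) ε k : ℂ) *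
        (Complex.exp (Complex.I * ω * ((k : ℂ) + ε)) -
          ∑ j ∈ Finset.range (2 * r + 2 + 1), (Complex.I * ω * ((k : ℂ) + ε)) ^ j / j !))
      =o[𝓝 0] fun ω : ℝ => ω ^ (2 * r + 2) := by
    intro k _
    have ht : Tendsto (fun ω : ℝ => Complex.I * ω * ((k : ℂ) + ε)) (𝓝 0) (𝓝 0) := by
      have : Continuous fun ω : ℝ => Complex.I * ω * ((k : ℂ) + ε) := by fun_prop
      simpa using this.tendsto 0
    refine IsLittleO.const_mul_left (((Complex.exp_sub_sum_range_succ_isLittleO_pow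
      (2 * r + 2)).comp_tendsto ht).trans_isBigO ?_) _
    refine IsBigO.of_bound (‖(k : ℂ) + ε‖ ^ (2 * r + 2)) (Eventually.of_forall fun ω => ?_)
    rw [Function.comp_apply, norm_pow, norm_pow, norm_mul, norm_mul, Complex.norm_I, one_mul,
      Complex.norm_real, mul_pow, mul_comm]
  refine (IsLittleO.sum hk).congr_left fun ω => ?_
  rw [Finset.sum_apply]

theorem isLittleO_one_sub_mul {g : ℝ → ℝ} (hg : Tendsto g (𝓝 0) (𝓝 0)) {F G : ℝ → ℂ} {a b : ℝ}
    (hF : (fun ω => F ω - (1 - (a * g ω : ℝ))) =o[𝓝 0] g)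
    (hG : (fun ω => G ω - (1 - (b * g ω : ℝ))) =o[𝓝 0] g) :
    (fun ω => F ω * G ω - (1 - ((a + b) * g ω : ℝ))) =o[𝓝 0] g := by
  have hg1 : g =o[𝓝 0] fun _ => (1 : ℝ) := (isLittleO_one_iff ℝ).2 hg
  have hb : (fun ω => (1 - (b * g ω : ℝ) : ℂ)) =O[𝓝 0] fun _ => (1 : ℝ) := by
    have : Tendsto (fun ω => (1 - ((b * g ω : ℝ) : ℂ))) (𝓝 0) (𝓝 (1 - ((b * 0 : ℝ) : ℂ))) :=
      tendsto_const_nhds.sub ((Complex.continuous_ofReal.tendsto _).comp (hg.const_mul b))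
    exact this.isBigO_one ℝ
  have hFb : F =O[𝓝 0] fun _ => (1 : ℝ) := by
    have ha : Tendsto (fun ω => (1 - ((a * g ω : ℝ) : ℂ))) (𝓝 0) (𝓝 (1 - ((a * 0 : ℝ) : ℂ))) :=
      tendsto_const_nhds.sub ((Complex.continuous_ofReal.tendsto _).comp (hg.const_mul a))
    have := (hF.trans hg1).isBigO.add (ha.isBigO_one ℝ)
    simpa using this
  have h1 := hFb.mul_isLittleO hG
  have h2 := hF.mul_isBigO hb
  have h3 : (fun ω => ((a * b : ℝ) : ℂ) * ((g ω : ℂ) * (g ω : ℂ))) =o[𝓝 0] g := by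
    refine IsLittleO.const_mul_left ?_ _
    have hgC : (fun ω => (g ω : ℂ)) =O[𝓝 0] g :=
      IsBigO.of_bound 1 (Eventually.of_forall fun ω => by simp)
    simpa using hgC.mul_isLittleO (hgC.trans_isLittleO hg1)
  simp only [one_mul, mul_one] at h1 h2
  refine ((h1.add h2).add h3).congr_left fun ω => ?_
  push_cast
  ring

theorem isLittleO_one_sub_pow {g : ℝ → ℝ} (hg : Tendsto g (𝓝 0) (𝓝 0)) {F : ℝ → ℂ} {a : ℝ}
    (hF : (fun ω => F ω - (1 - (a * g ω : ℝ))) =o[𝓝 0] g) (m : ℕ) :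
    (fun ω => F ω ^ m - (1 - (m * a * g ω : ℝ))) =o[𝓝 0] g := by
  induction m with
  | zero => simp
  | succ m ih =>
    refine (isLittleO_one_sub_mul hg ih hF).congr_left fun ω => ?_
    push_cast
    ring

/-! ### Space-time symbols in terms of the reduced symbol -/

theorem semiLagrangian_mulVec_spatialMode (p : ℕ) {n : ℕ} [NeZero n] (α δt : ℝ) {ω : ℝ}
    (hω : ω ∈ frequencies n) :
    ((semiLagrangian p n α δt).map Complex.ofReal) *ᵥ spatialMode n ω =
      (Complex.exp (-(Complex.I * ω * cfl n α δt)) *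
        reducedSymbol p (Int.fract (cfl n α δt)) ω) • spatialMode n ω := by
  ext i
  simp only [Matrix.mulVec, dotProduct, semiLagrangian, Matrix.map_apply, Matrix.of_apply,
    Complex.ofReal_sum, Finset.sum_mul, Pi.smul_apply, smul_eq_mul, reducedSymbol, Finset.mul_sum]
  rw [Finset.sum_comm]
  refine Finset.sum_congr rfl fun k _ => ?_
  rw [Finset.sum_eq_single (i + ((k - ⌊cfl n α δt⌋ : ℤ) : ZMod n))]
  · rw [if_pos rfl, spatialMode_add hω]
    have : Complex.exp (Complex.I * ω * ((k - ⌊cfl n α δt⌋ : ℤ) : ℂ)) =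
        Complex.exp (-(Complex.I * ω * cfl n α δt)) *
          Complex.exp (Complex.I * ω * ((k : ℂ) + (Int.fract (cfl n α δt) : ℝ))) := by
      rw [← Complex.exp_add]
      congr 1
      rw [Int.fract]
      push_cast
      ring
    rw [this]
    ring
  · intro b _ hb
    rw [if_neg hb]
    simp
  · intro h
    exact absurd (Finset.mem_univ _) h

theorem fourierSymbol_pow (p r : ℕ) {n : ℕ} [NeZero n] (α δt : ℝ) {ω : ℝ}
    (hω : ω ∈ frequencies n) (ϑ : ℝ) :
    fourierSymbol (semiLagrangian p n α δt ^ r) ω ϑ =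
      1 - reducedSymbol p (Int.fract (cfl n α δt)) ω ^ r *
        Complex.exp (-(Complex.I * (ϑ + r * (ω * cfl n α δt)))) := by
  have hs := semiLagrangian_mulVec_spatialMode p α δt hω
  set s := Complex.exp (-(Complex.I * ω * cfl n α δt)) *
        reducedSymbol p (Int.fract (cfl n α δt)) ω with hsdef
  have hr : ((semiLagrangian p n α δt ^ r).map Complex.ofReal) *ᵥ spatialMode n ω =
      s ^ r • spatialMode n ω := by
    have hmap : ∀ r : ℕ, (semiLagrangian p n α δt ^ r).map Complex.ofReal =
        ((semiLagrangian p n α δt).map Complex.ofReal) ^ r :=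
      map_pow (Complex.ofRealHom.mapMatrix (m := ZMod n)) _
    rw [hmap]
    induction r with
    | zero => simp
    | succ r ih =>
      rw [pow_succ', ← Matrix.mulVec_mulVec, ih, Matrix.mulVec_smul, hs, smul_smul, pow_succ]
  have hm : spaceTimeMode n ω ϑ (0 - 1) = Complex.exp (-(Complex.I * ϑ)) • spatialMode n ω := by
    ext j
    simp [spaceTimeMode, mul_comm]
  have h0 : spatialMode n ω 0 = 1 := by simp [spatialMode]
  simp only [fourierSymbol, spaceTimeOperator, hm, Matrix.mulVec_smul, hr, Pi.sub_apply,
    Pi.smul_apply, smul_eq_mul, h0, spaceTimeMode]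
  have : Complex.exp (-(Complex.I * (ϑ + r * (ω * cfl n α δt)))) =
      Complex.exp (-(Complex.I * ω * cfl n α δt)) ^ r * Complex.exp (-(Complex.I * ϑ)) := by
    rw [← Complex.exp_nat_mul, ← Complex.exp_add]
    congr 1
    ring
  rw [this, hsdef, mul_pow]
  simp
  ring

theorem cfl_nat_mul (n m : ℕ) (α δt : ℝ) : cfl n α (m * δt) = m * cfl n α δt := by
  unfold cfl; ring

theorem idealSymbol_eq (p m : ℕ) {n : ℕ} [NeZero n] (α δt : ℝ) {ω : ℝ}
    (hω : ω ∈ frequencies n) (θ : ℝ) :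
    idealSymbol p m n α δt ω θ = 1 - reducedSymbol p (Int.fract (cfl n α δt)) ω ^ m *
      Complex.exp (Complex.I * ((-(m * (θ + ω * cfl n α δt)) : ℝ) : ℂ)) := by
  rw [idealSymbol, fourierSymbol_pow p m α δt hω]
  congr 3
  push_cast
  ring

theorem coarseSymbol_eq (p m : ℕ) {n : ℕ} [NeZero n] (α δt : ℝ) {ω : ℝ}
    (hω : ω ∈ frequencies n) (θ : ℝ) :
    coarseSymbol p m n α δt ω θ = 1 - reducedSymbol p (Int.fract (m * cfl n α δt)) ω *
      Complex.exp (Complex.I * ((-(m * (θ + ω * cfl n α δt)) : ℝ) : ℂ)) := by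
  have h := fourierSymbol_pow p 1 α (m * δt) hω (m * θ)
  rw [pow_one, pow_one, cfl_nat_mul] at h
  rw [coarseSymbol, h]
  congr 3
  push_cast
  ring

theorem charDistance_eq (n : ℕ) (α δt ω θ : ℝ) :
    charDistance n α δt ω θ = |θ + ω * cfl n α δt| := by
  unfold charDistance cfl
  congr 2
  ring

/-! ### Uniform estimates for numerator and denominator -/

/-- Lets `K` enter only through `h₀`, so that the constants of the theorem can be fixed before `K`.
-/
theorem exists_meshWidth_bound {Q : ℝ → Prop} (hQ : ∀ᶠ ω in 𝓝 0, Q ω) {K : ℝ} (hK : 0 < K) :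
    ∃ h₀ : ℝ, 0 < h₀ ∧ ∀ n : ℕ, meshWidth n ≤ h₀ → ∀ ω : ℝ, |ω| ≤ K * meshWidth n → Q ω := by
  obtain ⟨ρ, hρ, hball⟩ := Metric.eventually_nhds_iff.1 hQ
  refine ⟨ρ / (2 * K), by positivity, fun n hn ω hω => hball ?_⟩
  rw [Real.dist_0_eq_abs]
  calc |ω| ≤ K * meshWidth n := hω
    _ ≤ K * (ρ / (2 * K)) := by gcongr
    _ = ρ / 2 := by field_simp
    _ < ρ := by linarith

theorem eventually_expansions (r m : ℕ) (c : ℝ) {a : ℝ} {η : ℝ} (hη : 0 < η) :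
    ∀ᶠ ω : ℝ in 𝓝 0,
      ‖reducedSymbol (2 * r + 1) (Int.fract (m * c)) ω -
        (1 - (dissipation r (Int.fract (m * c)) * |ω| ^ (2 * r + 2) : ℝ))‖
          ≤ η * |ω| ^ (2 * r + 2) ∧
      ‖reducedSymbol (2 * r + 1) (Int.fract c) ω ^ m -
        (1 - (m * dissipation r (Int.fract c) * |ω| ^ (2 * r + 2) : ℝ))‖
          ≤ η * |ω| ^ (2 * r + 2) ∧
      a * |ω| ^ (2 * r + 2) < 1 := by
  have heven : Even (2 * r + 2) := ⟨r + 1, by ring⟩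
  have hg : Tendsto (fun ω : ℝ => ω ^ (2 * r + 2)) (𝓝 0) (𝓝 0) := by
    have : Continuous fun ω : ℝ => ω ^ (2 * r + 2) := by fun_prop
    simpa using this.tendsto 0
  have h1 := (reducedSymbol_isLittleO r (Int.fract (m * c))).def hη
  have h2 := (isLittleO_one_sub_pow hg (reducedSymbol_isLittleO r (Int.fract c)) m).def hη
  have h3 : ∀ᶠ ω : ℝ in 𝓝 0, a * ω ^ (2 * r + 2) < 1 := by
    have := hg.const_mul a
    rw [mul_zero] at this
    exact this.eventually_lt_const one_pos
  filter_upwards [h1, h2, h3] with ω h1 h2 h3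
  simp only [Real.norm_eq_abs, abs_pow, heven.pow_abs] at h1 h2 ⊢
  exact ⟨h1, h2, h3⟩

/-- Dissipation suffices, whatever the phase: ‖z‖ ≤ 1 - (a - η)t ≤ 1 - (a/2)t. -/
theorem le_norm_one_sub_mul {z u : ℂ} {a η t : ℝ} (ht : 0 ≤ t) (hη : η ≤ a / 2) (hat : a * t < 1)
    (hu : ‖u‖ = 1) (hz : ‖z - (1 - (a * t : ℝ))‖ ≤ η * t) :
    a / 2 * t ≤ ‖1 - z * u‖ := by
  have h1 : ‖(1 - (a * t : ℝ) : ℂ)‖ = 1 - a * t := by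
    rw [← Complex.ofReal_one, ← Complex.ofReal_sub, Complex.norm_real, Real.norm_eq_abs,
      abs_of_pos (by linarith)]
  have h2 : ‖z‖ ≤ 1 - a * t + η * t := by
    have := norm_add_le (z - (1 - (a * t : ℝ))) (1 - (a * t : ℝ) : ℂ)
    rw [sub_add_cancel, h1] at this
    linarith
  have h3 := norm_sub_norm_le (1 : ℂ) (z * u)
  rw [norm_mul, hu, norm_one, mul_one] at h3
  nlinarith

theorem norm_one_sub_le {z : ℂ} {a η t : ℝ} (ht : 0 ≤ t) (ha : 0 ≤ a)
    (hz : ‖z - (1 - (a * t : ℝ))‖ ≤ η * t) : ‖1 - z‖ ≤ (a + η) * t := by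
  have h := norm_sub_le ((a * t : ℝ) : ℂ) (z - (1 - (a * t : ℝ)))
  have e : ((a * t : ℝ) : ℂ) - (z - (1 - (a * t : ℝ))) = 1 - z := by ring
  rw [e, Complex.norm_real, Real.norm_eq_abs, abs_of_nonneg (by positivity)] at h
  linarith

theorem abs_norm_sub_sub_le {z w u : ℂ} {a b η t : ℝ} (ht : 0 ≤ t) (hu : ‖u‖ = 1)
    (hz : ‖z - (1 - (a * t : ℝ))‖ ≤ η * t) (hw : ‖w - (1 - (b * t : ℝ))‖ ≤ η * t) :
    |‖(1 - z * u) - (1 - w * u)‖ - |a - b| * t| ≤ 2 * η * t := by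
  have e : (1 - z * u) - (1 - w * u) = (w - z) * u := by ring
  have e2 : |a - b| * t = ‖(((a - b) * t : ℝ) : ℂ)‖ := by
    rw [Complex.norm_real, Real.norm_eq_abs, abs_mul, abs_of_nonneg ht]
  rw [e, norm_mul, hu, mul_one, e2]
  refine (abs_norm_sub_norm_le _ _).trans ?_
  have e3 : w - z - (((a - b) * t : ℝ) : ℂ) =
      (w - (1 - (b * t : ℝ))) - (z - (1 - (a * t : ℝ))) := by
    push_cast; ring
  rw [e3]
  refine (norm_sub_le _ _).trans ?_
  linarith

theorem norm_exp_I_mul_sub_exp_le (x y : ℝ) :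
    ‖Complex.exp (Complex.I * x) - Complex.exp (Complex.I * y)‖ ≤ |x - y| := by
  have e : Complex.exp (Complex.I * x) - Complex.exp (Complex.I * y) =
      Complex.exp (Complex.I * y) * (Complex.exp (Complex.I * (x - y : ℝ)) - 1) := by
    rw [mul_sub, ← Complex.exp_add]
    push_cast
    ring_nf
  rw [e, norm_mul, Complex.norm_exp_I_mul_ofReal, one_mul]
  exact Real.norm_exp_I_mul_ofReal_sub_one_le

theorem le_norm_one_sub_exp {x : ℝ} (hx : |x| ≤ Real.pi) :
    2 / Real.pi * |x| ≤ ‖1 - Complex.exp (Complex.I * x)‖ := by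
  rw [norm_sub_rev, Complex.norm_exp_I_mul_ofReal_sub_one, norm_mul, Real.norm_eq_abs,
    Real.norm_eq_abs, abs_of_pos (two_pos : (0 : ℝ) < 2)]
  have h := Real.mul_abs_le_abs_sin (x := x / 2) (by
    rw [abs_div, abs_of_pos (two_pos : (0 : ℝ) < 2)]; linarith)
  rw [abs_div, abs_of_pos (two_pos : (0 : ℝ) < 2)] at h
  linarith

/-- Away from the characteristic frequency the coarse symbol is bounded away from zero. -/
theorem le_norm_one_sub_mul_of_far {m : ℕ} (hm : 1 ≤ m) {c δ θ ω κ : ℝ} {z : ℂ}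
    (hc : 0 < c) (hθ : θ ∈ lowFrequencies m) (hfar : δ ≤ |θ + ω * c|)
    (hz : ‖1 - z‖ ≤ κ) (hω : |ω| * c ≤ δ / 2) (hκ : κ + m * c * |ω| ≤ m * δ / (2 * Real.pi)) :
    m * δ / (2 * Real.pi) ≤
      ‖1 - z * Complex.exp (Complex.I * ((-(m * (θ + ω * c)) : ℝ) : ℂ))‖ := by
  have hm0 : (0 : ℝ) < m := by exact_mod_cast hm
  have hpi := Real.pi_pos
  have hmθ : |-(m * θ)| = m * |θ| := by rw [abs_neg, abs_mul, abs_of_pos hm0]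
  -- The phase is compared with -mθ, which lies in [-π, π], where Jordan's inequality holds; -m(θ +
  -- ωc) may leave that interval.
  have hle : |-(m * θ)| ≤ Real.pi := by
    have : |θ| ≤ Real.pi / m := abs_le.2 ⟨hθ.1, hθ.2.le⟩
    rw [hmθ]
    calc m * |θ| ≤ m * (Real.pi / m) := by gcongr
      _ = Real.pi := by field_simp
  have hge : δ / 2 ≤ |θ| := by
    have := abs_add_le θ (ω * c)
    rw [abs_mul, abs_of_pos hc] at this
    linarith
  have h1 := le_norm_one_sub_exp hle
  have h2 := norm_exp_I_mul_sub_exp_le (-(m * (θ + ω * c))) (-(m * θ))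
  have h2' : |-(m * (θ + ω * c)) - -(m * θ)| = m * c * |ω| := by
    rw [show -(m * (θ + ω * c)) - -(m * θ) = -(m * c * ω) by ring, abs_neg, abs_mul,
      abs_of_pos (by positivity)]
  rw [h2'] at h2
  set u := Complex.exp (Complex.I * ((-(m * (θ + ω * c)) : ℝ) : ℂ)) with hu
  set v := Complex.exp (Complex.I * ((-(m * θ) : ℝ) : ℂ))
  have hun : ‖u‖ = 1 := Complex.norm_exp_I_mul_ofReal _
  have h3 : ‖1 - v‖ ≤ ‖1 - z * u‖ + (m * c * |ω| + κ) := by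
    have e : 1 - v = (1 - z * u) + ((u - v) - (1 - z) * u) := by ring
    rw [e]
    refine (norm_add_le _ _).trans (add_le_add le_rfl ((norm_sub_le _ _).trans ?_))
    rw [norm_mul, hun, mul_one]
    exact add_le_add h2 hz
  -- Jordan's inequality gives twice the target; `hκ` spends half of it on the perturbation.
  have h4 : 2 * (m * δ / (2 * Real.pi)) ≤ 2 / Real.pi * |-(m * θ)| := by
    rw [hmθ]
    calc 2 * (m * δ / (2 * Real.pi)) = 2 / Real.pi * (m * (δ / 2)) := by field_simp
      _ ≤ _ := by gcongr
  linarith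

/-! ### The two error bounds -/

theorem coarse_error_upper (r m : ℕ) (hm : 1 ≤ m) (c : ℝ) (hc : 0 < c)
    (hcoarse : ∀ k : ℤ, m * c ≠ k) (δ : ℝ) (hδ : 0 < δ) :
    ∃ C : ℝ, 0 < C ∧ ∀ K : ℝ, 0 < K → ∃ h₀ : ℝ, 0 < h₀ ∧
      ∀ (n : ℕ) [NeZero n] (α δt : ℝ), cfl n α δt = c → meshWidth n ≤ h₀ →
      ∀ ω ∈ frequencies n, ω ≠ 0 → |ω| ≤ K * meshWidth n →
      ∀ θ ∈ lowFrequencies m,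
        coarseSymbol (2 * r + 1) m n α δt ω θ ≠ 0 ∧
        (δ ≤ charDistance n α δt ω θ →
          relativeCoarseError (2 * r + 1) m n α δt ω θ ≤ C * |ω| ^ (2 * r + 2)) ∧
        (charDistance n α δt ω θ < δ →
          relativeCoarseError (2 * r + 1) m n α δt ω θ ≤ C) := by
  have hm0 : (0 : ℝ) < m := by exact_mod_cast hm
  have hpi := Real.pi_pos
  have ha := dissipation_pos r (Int.fract_pos.2 (hcoarse _)) (Int.fract_lt_one (m * c))
  set a := dissipation r (Int.fract (m * c))
  set b := m * dissipation r (Int.fract c)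
  -- The numerator is at most N |ω|^(p+1): the remainder 2η is a for η = a/2.
  set N := |a - b| + a with hN
  have hNpos : 0 < N := by positivity
  set L := m * δ / (2 * Real.pi) with hL
  have hLpos : 0 < L := by positivity
  -- The first term serves the characteristic case, the second the far case.
  refine ⟨N / (a / 2) + N / L, by positivity, fun K hK => ?_⟩
  have hexp := eventually_expansions r m c (a := a) (half_pos ha)
  have hsmall : ∀ᶠ ω : ℝ in 𝓝 0, |ω| * c < δ / 2 := by
    have : Continuous fun ω : ℝ => |ω| * c := by fun_prop
    exact (this.tendsto 0).eventually_lt_const (by simpa using hδ)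
  have hsmall' : ∀ᶠ ω : ℝ in 𝓝 0, (a + a / 2) * |ω| ^ (2 * r + 2) + m * c * |ω| < L := by
    have : Continuous fun ω : ℝ => (a + a / 2) * |ω| ^ (2 * r + 2) + m * c * |ω| := by fun_prop
    exact (this.tendsto 0).eventually_lt_const (by simpa using hLpos)
  obtain ⟨h₀, hh₀, H⟩ := exists_meshWidth_bound ((hexp.and hsmall).and hsmall') hK
  refine ⟨h₀, hh₀, fun n _ α δt hcfl hn ω hω hω0 hωK θ hθ => ?_⟩
  obtain ⟨⟨⟨hz, hw, hat⟩, hs⟩, hs'⟩ := H n hn ω hωK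
  have ht : 0 < |ω| ^ (2 * r + 2) := pow_pos (abs_pos.2 hω0) _
  rw [charDistance_eq, relativeCoarseError, coarseSymbol_eq _ _ _ _ hω, idealSymbol_eq _ _ _ _ hω,
    hcfl]
  have hu := Complex.norm_exp_I_mul_ofReal (-(m * (θ + ω * c)))
  have hlow := le_norm_one_sub_mul ht.le le_rfl hat hu hz
  have hnum := (abs_le.1 (abs_norm_sub_sub_le ht.le hu hz hw)).2
  set D := 1 - reducedSymbol (2 * r + 1) (Int.fract (m * c)) ω *
    Complex.exp (Complex.I * ((-(m * (θ + ω * c)) : ℝ) : ℂ)) with hD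
  set t := |ω| ^ (2 * r + 2)
  have hDpos : 0 < ‖D‖ := lt_of_lt_of_le (by positivity) hlow
  refine ⟨norm_pos_iff.1 hDpos, fun hfar => ?_, fun _ => ?_⟩
  · have hfar' : L ≤ ‖D‖ := le_norm_one_sub_mul_of_far hm hc hθ hfar
      (norm_one_sub_le ht.le ha.le hz) hs.le hs'.le
    have h1 : (N / (a / 2) + N / L) * t * L ≤ (N / (a / 2) + N / L) * t * ‖D‖ := by gcongr
    have h2 : (N / (a / 2) + N / L) * t * L = N / (a / 2) * t * L + N * t := by
      field_simp
    have h3 : 0 ≤ N / (a / 2) * t * L := by positivity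
    rw [div_le_iff₀ hDpos]
    nlinarith
  · have h1 : (N / (a / 2) + N / L) * (a / 2 * t) ≤ (N / (a / 2) + N / L) * ‖D‖ := by gcongr
    have h2 : (N / (a / 2) + N / L) * (a / 2 * t) = N * t + N / L * (a / 2 * t) := by
      field_simp
    have h3 : 0 ≤ N / L * (a / 2 * t) := by positivity
    rw [div_le_iff₀ hDpos]
    nlinarith

theorem coarse_error_lower (r m : ℕ) (hm : 2 ≤ m) (c : ℝ)
    (hfine : ∀ k : ℤ, c ≠ k) (hcoarse : ∀ k : ℤ, m * c ≠ k) (B : ℝ) (hB : 0 ≤ B) :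
    ∃ b : ℝ, 0 < b ∧ ∀ K : ℝ, 0 < K → ∃ h₀ : ℝ, 0 < h₀ ∧
      ∀ (n : ℕ) [NeZero n] (α δt : ℝ), cfl n α δt = c → meshWidth n ≤ h₀ →
      ∀ ω ∈ frequencies n, ω ≠ 0 → |ω| ≤ K * meshWidth n →
      ∀ θ : ℝ, charDistance n α δt ω θ ≤ B * |ω| ^ (2 * r + 2) →
        b ≤ relativeCoarseError (2 * r + 1) m n α δt ω θ := by
  have hm0 : (0 : ℝ) < m := by exact_mod_cast (by omega : 0 < m)
  have hfr : Int.fract (m * Int.fract c) = Int.fract (m * c) := by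
    rw [Int.fract_eq_fract]
    refine ⟨-(m * ⌊c⌋), ?_⟩
    rw [Int.fract]
    push_cast
    ring
  have ha := dissipation_pos r (Int.fract_pos.2 (hcoarse _)) (Int.fract_lt_one (m * c))
  have hlt := dissipation_fract_lt r (Int.fract_pos.2 (hfine _)) (Int.fract_lt_one c) hm
    (by rw [hfr]; exact Int.fract_pos.2 (hcoarse _))
  rw [hfr] at hlt
  set a := dissipation r (Int.fract (m * c))
  set b := m * dissipation r (Int.fract c)
  set d := |a - b| with hd
  have hdpos : 0 < d := abs_pos.2 (by linarith)
  -- The bound d/4 keeps the numerator above (d/2) |ω|^(p+1), and a/2 keeps the denominator nonzero.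
  set η := min (d / 4) (a / 2) with hη
  have hηpos : 0 < η := lt_min (by positivity) (by positivity)
  have hη1 : η ≤ d / 4 := min_le_left _ _
  have hη2 : η ≤ a / 2 := min_le_right _ _
  -- In the denominator, mB bounds the phase deviation and a + η the dissipation, both in units of
  -- |ω|^(p+1).
  refine ⟨d / 2 / (m * B + (a + η)), by positivity, fun K hK => ?_⟩
  obtain ⟨h₀, hh₀, H⟩ := exists_meshWidth_bound (eventually_expansions r m c (a := a) hηpos) hK
  refine ⟨h₀, hh₀, fun n _ α δt hcfl hn ω hω hω0 hωK θ hchar => ?_⟩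
  obtain ⟨hz, hw, hat⟩ := H n hn ω hωK
  have ht : 0 < |ω| ^ (2 * r + 2) := pow_pos (abs_pos.2 hω0) _
  rw [charDistance_eq, hcfl] at hchar
  rw [relativeCoarseError, coarseSymbol_eq _ _ _ _ hω, idealSymbol_eq _ _ _ _ hω, hcfl]
  have hu := Complex.norm_exp_I_mul_ofReal (-(m * (θ + ω * c)))
  have hlow := le_norm_one_sub_mul ht.le hη2 hat hu hz
  have hnum := (abs_le.1 (abs_norm_sub_sub_le ht.le hu hz hw)).1
  have hone := norm_one_sub_le ht.le ha.le hz
  have hphase : ‖1 - Complex.exp (Complex.I * ((-(m * (θ + ω * c)) : ℝ) : ℂ))‖ ≤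
      m * B * |ω| ^ (2 * r + 2) := by
    have := Real.norm_exp_I_mul_ofReal_sub_one_le (x := -(m * (θ + ω * c)))
    rw [norm_sub_rev, Real.norm_eq_abs, abs_neg, abs_mul, abs_of_pos hm0] at this
    refine this.trans ?_
    rw [mul_assoc]
    gcongr
  set u := Complex.exp (Complex.I * ((-(m * (θ + ω * c)) : ℝ) : ℂ))
  set z := reducedSymbol (2 * r + 1) (Int.fract (m * c)) ω
  set t := |ω| ^ (2 * r + 2)
  have hup : ‖1 - z * u‖ ≤ (m * B + (a + η)) * t := by
    have e : 1 - z * u = (1 - u) + (1 - z) * u := by ring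
    rw [e]
    refine (norm_add_le _ _).trans ?_
    rw [norm_mul, hu, mul_one]
    linarith
  have hDpos : 0 < ‖1 - z * u‖ := lt_of_lt_of_le (by positivity) hlow
  rw [le_div_iff₀ hDpos]
  calc d / 2 / (m * B + (a + η)) * ‖1 - z * u‖
      ≤ d / 2 / (m * B + (a + η)) * ((m * B + (a + η)) * t) := by gcongr
    _ = d / 2 * t := by
      have : m * B + (a + η) ≠ 0 := by positivity
      field_simp
    _ ≤ _ := by nlinarith

end MGRITAdvection

end

open MGRITAdvection

theorem theorem6p1 (p m : ℕ) (hp : Odd p) (hm : 1 ≤ m) (c : ℝ) (hc : 0 < c)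
    (hfine : ∀ k : ℤ, c ≠ k) (hcoarse : ∀ k : ℤ, m * c ≠ k) :
    -- upper bounds: order `p + 1` away from the characteristic frequency, order zero near it
    (∀ δ : ℝ, 0 < δ → ∃ C : ℝ, 0 < C ∧ ∀ K : ℝ, 0 < K → ∃ h₀ : ℝ, 0 < h₀ ∧
      ∀ (n : ℕ) [NeZero n] (α δt : ℝ), 0 < α → 0 < δt → cfl n α δt = c → meshWidth n ≤ h₀ →
      ∀ ω ∈ frequencies n, ω ≠ 0 → |ω| ≤ K * meshWidth n →
      ∀ θ ∈ lowFrequencies m,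
        coarseSymbol p m n α δt ω θ ≠ 0 ∧
        (δ ≤ charDistance n α δt ω θ →
          relativeCoarseError p m n α δt ω θ ≤ C * |ω| ^ (p + 1)) ∧
        (charDistance n α δt ω θ < δ →
          relativeCoarseError p m n α δt ω θ ≤ C)) ∧
    -- the correction of characteristic components is of order zero and no better
    (2 ≤ m → ∀ B : ℝ, 0 ≤ B → ∃ b : ℝ, 0 < b ∧ ∀ K : ℝ, 0 < K → ∃ h₀ : ℝ, 0 < h₀ ∧
      ∀ (n : ℕ) [NeZero n] (α δt : ℝ), 0 < α → 0 < δt → cfl n α δt = c → meshWidth n ≤ h₀ →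
      ∀ ω ∈ frequencies n, ω ≠ 0 → |ω| ≤ K * meshWidth n →
      ∀ θ ∈ lowFrequencies m, charDistance n α δt ω θ ≤ B * |ω| ^ (p + 1) →
        b ≤ relativeCoarseError p m n α δt ω θ) := by
  obtain ⟨r, rfl⟩ := hp
  refine ⟨fun δ hδ => ?_, fun hm2 B hB => ?_⟩
  · obtain ⟨C, hC, H⟩ := coarse_error_upper r m hm c hc hcoarse δ hδ
    refine ⟨C, hC, fun K hK => ?_⟩
    obtain ⟨h₀, hh₀, H⟩ := H K hK
    exact ⟨h₀, hh₀, fun n _ α δt _ _ => H n α δt⟩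
  · obtain ⟨b, hb, H⟩ := coarse_error_lower r m hm2 c hfine hcoarse B hB
    refine ⟨b, hb, fun K hK => ?_⟩
    obtain ⟨h₀, hh₀, H⟩ := H K hK
    exact ⟨h₀, hh₀, fun n _ α δt _ _ hcfl hn ω hω hω0 hωK θ _ => H n α δt hcfl hn ω hω hω0 hωK θ⟩
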